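/- A graph with $s$ legs is a finite non-empty multigraph $G=(V,E)$ (loops and parallel edges allowed) with $s$ labelled legs, each attached to a vertex; its rank is $|E|-|V|+1$ if $G$ is connected. It is admissible if it is connected, remains connected upon removal of any single edge, and every vertex has valency at least $3$ (each leg counts once, each loop counts twice). For $m,n,s\in\mathbb N$ let $X$ be the set of triples $(G,\lambda,c)$, where $G$ is an admissible graph of rank $n$ with $s$ legs, $c:E\to\{1,\dots,m\}$ is any map (a coloring), and $\lambda:E\to\mathbb R_{\ge 0}$ satisfies $\sum_{e\in E}\lambda(e)=1$ and vanishes only on a forest. Give $X$ the topology of the disjoint union, over all colored graphs $(G,c)$, of the sets of admitted $\lambda$, each regarded as a subspace of $\mathbb R^E$. Let $(G,\lambda,c)\sim(G',\lambda',c')$ if, for $Z=\{\lambda=0\}$ and $Z'=\{\lambda'=0\}$, there is an isomorphism $G/Z\to G'/Z'$ of the graphs with these edges collapsed that preserves the labelled legs, the edge lengths and the colors. The moduli space of $m$-colored graphs $\mathcal{MCG}^m_{n,s}$ is the quotient space $X/{\sim}$, and $X^m_s:=\mathcal{MCG}^m_{1,s}$ is its one-loop case. \textbf{Proposition.} For every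 integer $m\ge 1$ the space $X_2^m$ is path-connected, and for every base point its fundamental group is free of rank $\tfrac12(m-1)(m-2)$: $$\pi_1(X_2^m)\cong F_{\frac12(m-1)(m-2)}.$$ -/

import Mathlib

open scoped Topology

/-- A multigraph with vertices `V`, (internal) edges `E` (loops and parallel edges allowed)
and `s` labelled legs. A leg is recorded by the vertex to which it is attached. -/
structure LegGraph (V E : Type*) (s : ℕ) where
  /-- the unordered pair of end points of an edge; a loop at `v` has end points `s(v, v)` -/
  ends : E → Sym2 V
  /-- the vertex carrying the `i`-th leg -/
  leg : Fin s → V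

namespace LegGraph

variable {V E V' E' V'' E'' : Type*} {s : ℕ}

/-- `u` and `v` are joined by a path all of whose edges lie in `F`. -/
def joined (G : LegGraph V E s) (F : Set E) : Setoid V :=
  Relation.EqvGen.setoid fun u v => ∃ e ∈ F, G.ends e = s(u, v)

/-- The connected components of the spanning subgraph with edge set `F`. -/
def Components (G : LegGraph V E s) (F : Set E) : Type _ := Quotient (G.joined F)

/-- The spanning subgraph with edge set `F` is connected (and non-empty). -/
def ConnectedOn (G : LegGraph V E s) (F : Set E) : Prop :=
  Nonempty V ∧ ∀ u v : V, (G.joined F).r u v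

/-- The rank (loop number, first Betti number) `|F| - |V| + #components` of the spanning subgraph
with edge set `F`; here `V` and `E` are finite. -/
noncomputable def rankOn (G : LegGraph V E s) (F : Set E) : ℤ :=
  (F.ncard : ℤ) - (Nat.card V : ℤ) + (Nat.card (G.Components F) : ℤ)

/-- The rank (loop number) of the graph. -/
noncomputable def rank (G : LegGraph V E s) : ℤ := G.rankOn Set.univ

/-- A set of edges is a forest if the subgraph that it spans has no loops. -/
def IsForest (G : LegGraph V E s) (F : Set E) : Prop := G.rankOn F = 0

/-- The number of edge ends and legs at `v`; an edge that is a loop at `v` counts twice. -/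
noncomputable def valency (G : LegGraph V E s) (v : V) : ℕ :=
  {e | v ∈ G.ends e}.ncard + {e | G.ends e = s(v, v)}.ncard + {i | G.leg i = v}.ncard

/-- Connected, and still connected upon removal of any edge (one-particle irreducible). -/
def IsCore (G : LegGraph V E s) : Prop :=
  G.ConnectedOn Set.univ ∧ ∀ e : E, G.ConnectedOn {e}ᶜ

/-- One-particle irreducible with all valencies at least three. -/
def IsAdmissible (G : LegGraph V E s) : Prop :=
  G.IsCore ∧ ∀ v : V, 3 ≤ G.valency v

/-- The graph `G / Z` with all edges in `Z` collapsed: its vertices are the components of the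
spanning subgraph with edge set `Z`, its edges are the edges of `G` outside `Z`. -/
def contract (G : LegGraph V E s) (Z : Set E) :
    LegGraph (G.Components Z) {e : E // e ∉ Z} s where
  ends e := (G.ends e.1).map (Quotient.mk (G.joined Z))
  leg i := Quotient.mk (G.joined Z) (G.leg i)

/-- Isomorphisms of graphs preserving the labelled legs. -/
structure Iso (G : LegGraph V E s) (G' : LegGraph V' E' s) where
  vertexEquiv : V ≃ V'
  edgeEquiv : E ≃ E'
  ends_map : ∀ e, G'.ends (edgeEquiv e) = (G.ends e).map vertexEquiv
  leg_map : ∀ i, G'.leg i = vertexEquiv (G.leg i)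

namespace Iso

/-- The identity isomorphism. -/
def refl (G : LegGraph V E s) : Iso G G where
  vertexEquiv := Equiv.refl V
  edgeEquiv := Equiv.refl E
  ends_map e := by simp
  leg_map i := rfl

/-- The inverse isomorphism. -/
def symm {G : LegGraph V E s} {G' : LegGraph V' E' s} (f : Iso G G') : Iso G' G where
  vertexEquiv := f.vertexEquiv.symm
  edgeEquiv := f.edgeEquiv.symm
  ends_map e := by
    have h := f.ends_map (f.edgeEquiv.symm e)
    rw [Equiv.apply_symm_apply] at h
    rw [h, Sym2.map_map]
    simp
  leg_map i := by rw [f.leg_map i, Equiv.symm_apply_apply]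

/-- The composition of two isomorphisms. -/
def trans {G : LegGraph V E s} {G' : LegGraph V' E' s} {G'' : LegGraph V'' E'' s}
    (f : Iso G G') (g : Iso G' G'') : Iso G G'' where
  vertexEquiv := f.vertexEquiv.trans g.vertexEquiv
  edgeEquiv := f.edgeEquiv.trans g.edgeEquiv
  ends_map e := by
    rw [Equiv.trans_apply, g.ends_map, f.ends_map, Sym2.map_map]
    rfl
  leg_map i := by rw [g.leg_map, f.leg_map, Equiv.trans_apply]

end Iso

end LegGraph

/-- An admissible `m`-colored graph of rank `n` with `s` labelled legs. Up to isomorphism, the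
vertices and the edges of a finite graph are `0, …, numV - 1` and `0, …, numE - 1`. -/
structure ColoredGraph (m n s : ℕ) where
  numV : ℕ
  numE : ℕ
  graph : LegGraph (Fin numV) (Fin numE) s
  admissible : graph.IsAdmissible
  rank_eq : graph.rank = n
  color : Fin numE → Fin m

/-- The regular metrics of volume one on a colored graph: non-negative edge lengths with sum one
that vanish only on a forest. It is a simplex, possibly with some faces missing, and carries the
subspace topology of `ℝ ^ E`. -/
def ColoredGraph.RegularMetric {m n s : ℕ} (Γ : ColoredGraph m n s) : Type :=
  {l : Fin Γ.numE → ℝ // (∀ e, 0 ≤ l e) ∧ ∑ e, l e = 1 ∧ Γ.graph.IsForest {e | l e = 0}}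

instance {m n s : ℕ} (Γ : ColoredGraph m n s) : TopologicalSpace Γ.RegularMetric :=
  inferInstanceAs (TopologicalSpace
    {l : Fin Γ.numE → ℝ // (∀ e, 0 ≤ l e) ∧ ∑ e, l e = 1 ∧ Γ.graph.IsForest {e | l e = 0}})

/-- Admissible `m`-colored graphs of rank `n` with `s` legs and a regular metric of volume one,
topologized as the disjoint union of the spaces of metrics over all colored graphs. -/
abbrev ColoredMetricGraph (m n s : ℕ) : Type :=
  Σ Γ : ColoredGraph m n s, Γ.RegularMetric

namespace ColoredMetricGraph

variable {m n s : ℕ}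

/-- The set of edges of length zero. -/
def zeroEdges (x : ColoredMetricGraph m n s) : Set (Fin x.1.numE) := {e | x.2.1 e = 0}

/-- Two colored metric graphs are equivalent if, after collapsing all edges of length zero, there
is an isomorphism that preserves the legs, the edge lengths and the colors. -/
def Equivalent (x y : ColoredMetricGraph m n s) : Prop :=
  ∃ φ : LegGraph.Iso (x.1.graph.contract x.zeroEdges) (y.1.graph.contract y.zeroEdges),
    ∀ e, y.2.1 (φ.edgeEquiv e).1 = x.2.1 e.1 ∧ y.1.color (φ.edgeEquiv e).1 = x.1.color e.1

theorem equivalence : Equivalence (Equivalent (m := m) (n := n) (s := s)) where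
  refl x := ⟨LegGraph.Iso.refl _, fun _ => ⟨rfl, rfl⟩⟩
  symm := by
    rintro x y ⟨φ, h⟩
    refine ⟨φ.symm, fun e => ?_⟩
    have h' := h (φ.edgeEquiv.symm e)
    rw [Equiv.apply_symm_apply] at h'
    exact ⟨h'.1.symm, h'.2.symm⟩
  trans := by
    rintro x y z ⟨φ, h⟩ ⟨ψ, k⟩
    exact ⟨φ.trans ψ, fun e => ⟨(k (φ.edgeEquiv e)).1.trans (h e).1,
      (k (φ.edgeEquiv e)).2.trans (h e).2⟩⟩

/-- Equivalence of colored metric graphs as a setoid. -/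
def setoid (m n s : ℕ) : Setoid (ColoredMetricGraph m n s) := ⟨Equivalent, equivalence⟩

end ColoredMetricGraph

/-- The moduli space of `m`-colored graphs of rank `n` with `s` legs, with the quotient topology. -/
def MCG (m n s : ℕ) : Type := Quotient (ColoredMetricGraph.setoid m n s)

instance (m n s : ℕ) : TopologicalSpace (MCG m n s) :=
  inferInstanceAs (TopologicalSpace (Quotient (ColoredMetricGraph.setoid m n s)))

/-! The space is a graph up to homeomorphism. In rank one `|E| = |V|`, so the valency condition
leaves at most two vertices: either a loop carrying both legs, or two parallel edges joining the two
legs. With colors `a ≠ b` the latter sweep out a segment, whose ends are the loops colored `a` and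
`b`. With `a = b`, exchanging the edges folds the segment at its midpoint, giving a whisker at the
vertex `a`. The result is the complete graph on the `m` colors with a whisker at each vertex. The
star of one vertex is a spanning tree of the complete graph, and `m(m-1)/2 - (m-1) = (m-1)(m-2)/2`
edges lie outside it.

This picture is made rigorous by `MCG.coord`, a continuous injection of a compact space into a real
vector space, hence an embedding. The open stars of the vertices are star-convex in these
coordinates, two of them meet in an open segment, and three never meet.

For any such cover, `nonempty_fundamentalGroup_mulEquiv` computes the fundamental group. Subdividing
a loop shows that the edges outside the tree generate. A covering space with fibre the free group,
glued by the generators, shows that there are no relations: the holonomy of the loop of a word is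
that word. -/

/-! ### Holonomy of locally constant cocycles. -/

section Holonomy

variable {X ι G : Type*} [TopologicalSpace X] [Group G]

/-- An open cover of `X`, with a group-valued cocycle of constant functions on its overlaps. -/
structure ConstantCocycle (X ι G : Type*) [TopologicalSpace X] [Group G] where
  set : ι → Set X
  isOpen_set : ∀ a, IsOpen (set a)
  index : X → ι
  mem_index : ∀ x, x ∈ set (index x)
  change : ι → ι → G
  change_mul : ∀ a b c, (set a ∩ set b ∩ set c).Nonempty → change b c * change a b = change a c

namespace ConstantCocycle

variable (Z : ConstantCocycle X ι G)

theorem change_self {a : ι} {x : X} (hx : x ∈ Z.set a) : Z.change a a = 1 := by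
  simpa using Z.change_mul a a a ⟨x, ⟨hx, hx⟩, hx⟩

variable [TopologicalSpace G] [DiscreteTopology G]

/-- The principal bundle of a cocycle, with the cocycle acting by left multiplication. -/
def bundleCore : FiberBundleCore ι X G where
  baseSet := Z.set
  isOpen_baseSet := Z.isOpen_set
  indexAt := Z.index
  mem_baseSet_at := Z.mem_index
  coordChange a b _ v := Z.change a b * v
  coordChange_self a x hx v := by simp [Z.change_self hx]
  continuousOn_coordChange a b :=
    ((continuous_of_discreteTopology (f := fun v : G => Z.change a b * v)).comp
      continuous_snd).continuousOn
  coordChange_comp a b c x hx v := by rw [← mul_assoc, Z.change_mul a b c ⟨x, hx⟩]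

theorem isCoveringMap_proj : IsCoveringMap Z.bundleCore.proj :=
  FiberBundle.isCoveringMap (E := Z.bundleCore.Fiber)

/-- The coordinate of a point of the bundle in the trivialization over `Z.set a`. -/
def coord (a : ι) (e : Z.bundleCore.TotalSpace) : G := (Z.bundleCore.localTriv a e).2

theorem coord_change {a b : ι} {e : Z.bundleCore.TotalSpace} (ha : e.1 ∈ Z.set a)
    (hb : e.1 ∈ Z.set b) : Z.coord b e = Z.change a b * Z.coord a e := by
  have h : ∀ v : G, Z.change (Z.index e.1) b * v =
      Z.change a b * (Z.change (Z.index e.1) a * v) := fun v => by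
    rw [← mul_assoc, Z.change_mul _ a b ⟨e.1, ⟨Z.mem_index _, ha⟩, hb⟩]
  exact h e.2

/-- In the coordinates over `Z.set a` and `Z.set b`, the monodromy along `γ` is left
multiplication by `g`. -/
def HasHolonomy {x y : X} (γ : Path.Homotopic.Quotient x y) (a b : ι) (g : G) : Prop :=
  ∀ e, Z.coord b (Z.isCoveringMap_proj.monodromy γ e).1 = g * Z.coord a e.1

theorem HasHolonomy.unique {x y : X} {γ : Path.Homotopic.Quotient x y} {a b : ι} {g h : G}
    (hg : Z.HasHolonomy γ a b g) (hh : Z.HasHolonomy γ a b h) : g = h :=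
  mul_right_cancel ((hg ⟨⟨x, (1 : G)⟩, rfl⟩).symm.trans (hh ⟨⟨x, (1 : G)⟩, rfl⟩))

theorem HasHolonomy.trans {x y z : X} {γ : Path.Homotopic.Quotient x y}
    {γ' : Path.Homotopic.Quotient y z} {a b c : ι} {g h : G}
    (hg : Z.HasHolonomy γ a b g) (hh : Z.HasHolonomy γ' b c h) :
    Z.HasHolonomy (γ.trans γ') a c (h * g) := fun e => by
  rw [Z.isCoveringMap_proj.monodromy_trans_apply, hh, hg, mul_assoc]

theorem hasHolonomy_refl {x : X} {a b : ι} (ha : x ∈ Z.set a) (hb : x ∈ Z.set b) :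
    Z.HasHolonomy (.refl x) a b (Z.change a b) := fun e => by
  rw [Z.isCoveringMap_proj.monodromy_refl]
  have he : e.1.1 = x := e.2
  exact Z.coord_change (e := e.1) (by rwa [he]) (by rwa [he])

theorem HasHolonomy.symm {x y : X} {γ : Path.Homotopic.Quotient x y} {a b : ι} {g : G}
    (hg : Z.HasHolonomy γ a b g) : Z.HasHolonomy γ.symm b a g⁻¹ := fun e => by
  have h := hg (Z.isCoveringMap_proj.monodromy γ.symm e)
  rw [← Z.isCoveringMap_proj.monodromy_trans_apply, Path.Homotopic.Quotient.symm_trans,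
    Z.isCoveringMap_proj.monodromy_refl] at h
  rw [eq_inv_mul_iff_mul_eq, ← h]
  rfl

/-- Keeping the coordinate over `Z.set a` constant gives a continuous lift of the path, and the
monodromy is the end point of any lift. -/
theorem hasHolonomy_of_forall_mem {x y : X} {p : Path x y} {a : ι} (hp : ∀ t, p t ∈ Z.set a) :
    Z.HasHolonomy (.mk p) a a 1 := by
  rintro ⟨e, he⟩
  obtain rfl : e.1 = x := he
  have hea : e ∈ (Z.bundleCore.localTriv a).source := by
    have := hp 0
    rw [p.source] at this
    exact this
  let lift : unitInterval → Z.bundleCore.TotalSpace := fun t =>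
    (Z.bundleCore.localTriv a).toOpenPartialHomeomorph.symm (p t, Z.coord a e)
  have hmem : ∀ t, (p t, Z.coord a e) ∈ (Z.bundleCore.localTriv a).target := fun t =>
    (Z.bundleCore.mem_localTriv_target a _).2 (hp t)
  have hlift : Continuous lift :=
    (Z.bundleCore.localTriv a).toOpenPartialHomeomorph.continuousOn_symm.comp_continuous
      (by fun_prop) hmem
  have h0 : lift 0 = e := by
    have := (Z.bundleCore.localTriv a).toOpenPartialHomeomorph.left_inv hea
    simp only [lift, p.source]
    exact this
  have h1 : (lift 1).1 = y := p.target
  have key : Z.isCoveringMap_proj.monodromy (.mk p) ⟨e, rfl⟩ = ⟨lift 1, h1⟩ := by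
    refine Z.isCoveringMap_proj.monodromy_eq_of_map_eq
      (.mk ⟨⟨lift, hlift⟩, h0, rfl⟩) (congrArg Path.Homotopic.Quotient.mk ?_)
    ext t
    rfl
  have hkey : Z.coord a (lift 1) = Z.coord a e := by
    have := (Z.bundleCore.localTriv a).toOpenPartialHomeomorph.right_inv (hmem 1)
    have h2 := congrArg Prod.snd this
    exact h2
  rw [key, one_mul, hkey]

end ConstantCocycle

end Holonomy

/-! ### Fundamental group of a space covered with a complete graph as nerve. -/

theorem IsSimplyConnected.mk_eq_mk {X : Type*} [TopologicalSpace X] {U : Set X}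
    (hU : IsSimplyConnected U) {x y : X} {p q : Path x y} (hp : ∀ t, p t ∈ U)
    (hq : ∀ t, q t ∈ U) : Path.Homotopic.Quotient.mk p = .mk q := by
  have := hU.simplyConnectedSpace
  have hx : x ∈ U := by simpa using hp 0
  have hy : y ∈ U := by simpa using hp 1
  let lift : ∀ r : Path x y, (∀ t, r t ∈ U) → Path (⟨x, hx⟩ : U) ⟨y, hy⟩ := fun r hr =>
    ⟨⟨fun t => ⟨r t, hr t⟩, by fun_prop⟩, Subtype.ext r.source, Subtype.ext r.target⟩
  exact Path.Homotopic.Quotient.eq.2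
    ((SimplyConnectedSpace.paths_homotopic (lift p hp) (lift q hq)).map ⟨Subtype.val, by fun_prop⟩)

namespace Path.Homotopic.Quotient

variable {X : Type*} [TopologicalSpace X] {x y z : X}

theorem symm_symm (γ : Path.Homotopic.Quotient x y) : γ.symm.symm = γ := by
  induction γ using Quotient.ind with | mk p => simp [← mk_symm]

theorem symm_of_trans (γ : Path.Homotopic.Quotient x y) (γ' : Path.Homotopic.Quotient y z) :
    (γ.trans γ').symm = γ'.symm.trans γ.symm := by
  induction γ using Quotient.ind with | mk p =>
  induction γ' using Quotient.ind with | mk q =>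
  simp [← mk_symm, ← mk_trans, Path.trans_symm]

end Path.Homotopic.Quotient

/-- A cover by simply connected open sets with non-empty path-connected pairwise intersections
and without triple intersections. -/
structure CompleteGraphCover (X ι : Type*) [TopologicalSpace X] where
  set : ι → Set X
  isOpen_set : ∀ a, IsOpen (set a)
  exists_mem : ∀ x, ∃ a, x ∈ set a
  isSimplyConnected : ∀ a, IsSimplyConnected (set a)
  isPathConnected_inter : ∀ a b, IsPathConnected (set a ∩ set b)
  eq_of_mem : ∀ a b c, (set a ∩ set b ∩ set c).Nonempty → a = b ∨ b = c ∨ a = c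

namespace CompleteGraphCover

open Path

variable {X ι : Type*} [TopologicalSpace X] (C : CompleteGraphCover X ι)

/-- The homotopy class of the paths in `C.set a` between two given points. -/
noncomputable def pathIn (a : ι) {x y : X} (hx : x ∈ C.set a) (hy : y ∈ C.set a) :
    Homotopic.Quotient x y :=
  .mk ((C.isSimplyConnected a).isPathConnected.joinedIn x hx y hy).somePath

theorem mk_eq_pathIn {a : ι} {x y : X} {p : Path x y} (hp : ∀ t, p t ∈ C.set a)
    (hx : x ∈ C.set a) (hy : y ∈ C.set a) : Homotopic.Quotient.mk p = C.pathIn a hx hy :=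
  (C.isSimplyConnected a).mk_eq_mk hp (JoinedIn.somePath_mem _)

theorem exists_pathIn_eq {a : ι} {x y : X} (hx : x ∈ C.set a) (hy : y ∈ C.set a) :
    ∃ p : Path x y, (∀ t, p t ∈ C.set a) ∧ C.pathIn a hx hy = .mk p :=
  ⟨_, JoinedIn.somePath_mem _, rfl⟩

theorem pathIn_self {a : ι} {x : X} (hx : x ∈ C.set a) : C.pathIn a hx hx = .refl x :=
  (C.mk_eq_pathIn (p := Path.refl x) (fun _ => hx) hx hx).symm

theorem pathIn_trans {a : ι} {x y z : X} (hx : x ∈ C.set a) (hy : y ∈ C.set a)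
    (hz : z ∈ C.set a) : (C.pathIn a hx hy).trans (C.pathIn a hy hz) = C.pathIn a hx hz := by
  obtain ⟨p, hp, h⟩ := C.exists_pathIn_eq hx hy
  obtain ⟨q, hq, h'⟩ := C.exists_pathIn_eq hy hz
  rw [h, h', ← Homotopic.Quotient.mk_trans]
  refine C.mk_eq_pathIn (fun t => ?_) hx hz
  have : (p.trans q) t ∈ Set.range p ∪ Set.range q := Path.trans_range p q ▸ Set.mem_range_self t
  rcases this with ⟨s, hs⟩ | ⟨s, hs⟩
  exacts [hs ▸ hp s, hs ▸ hq s]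

/-- A path inside the path-connected intersection represents both classes. -/
theorem pathIn_eq_pathIn {a b : ι} {x y : X} (hxa : x ∈ C.set a) (hya : y ∈ C.set a)
    (hxb : x ∈ C.set b) (hyb : y ∈ C.set b) : C.pathIn a hxa hya = C.pathIn b hxb hyb := by
  have h := (C.isPathConnected_inter a b).joinedIn x ⟨hxa, hxb⟩ y ⟨hya, hyb⟩
  rw [← C.mk_eq_pathIn (fun t => (h.somePath_mem t).1), C.mk_eq_pathIn
    (fun t => (h.somePath_mem t).2)]

variable (o : ι)

/-- A point in the intersection of `C.set o` and `C.set a`. -/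
noncomputable def point (a : ι) : X := (C.isPathConnected_inter o a).nonempty.some

theorem point_mem_left (a : ι) : C.point o a ∈ C.set o :=
  (C.isPathConnected_inter o a).nonempty.some_mem.1

theorem point_mem_right (a : ι) : C.point o a ∈ C.set a :=
  (C.isPathConnected_inter o a).nonempty.some_mem.2

/-- The class of the paths from the base point to `x` that run through `C.set o` and then
through `C.set a`. -/
noncomputable def pathTo (a : ι) {x : X} (hx : x ∈ C.set a) : Homotopic.Quotient (C.point o o) x :=
  (C.pathIn o (C.point_mem_left o o) (C.point_mem_left o a)).trans
    (C.pathIn a (C.point_mem_right o a) hx)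

theorem pathTo_trans_pathIn {a : ι} {x y : X} (hx : x ∈ C.set a) (hy : y ∈ C.set a) :
    (C.pathTo o a hx).trans (C.pathIn a hx hy) = C.pathTo o a hy := by
  rw [pathTo, Homotopic.Quotient.trans_assoc, pathIn_trans, pathTo]

theorem pathTo_base {x : X} (hx : x ∈ C.set o) :
    C.pathTo o o hx = C.pathIn o (C.point_mem_left o o) hx := by
  rw [pathTo, pathIn_trans]

/-- The class of the loops that run from `C.set o` to `C.set a`, to `C.set b` and back. -/
noncomputable def loop (a b : ι) : Homotopic.Quotient (C.point o o) (C.point o o) :=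
  (C.pathTo o a (C.point_mem_left a b)).trans (C.pathTo o b (C.point_mem_right a b)).symm

/-- Moving the crossing point within the intersection changes both halves by the same class, which
cancels. Hence the loop depends only on the pair of indices. -/
theorem pathTo_trans_symm {a b : ι} {x : X} (ha : x ∈ C.set a) (hb : x ∈ C.set b) :
    (C.pathTo o a ha).trans (C.pathTo o b hb).symm = C.loop o a b := by
  rw [loop, ← C.pathTo_trans_pathIn o ha (C.point_mem_left a b),
    ← C.pathTo_trans_pathIn o hb (C.point_mem_right a b),
    C.pathIn_eq_pathIn ha (C.point_mem_left a b) hb (C.point_mem_right a b)]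
  rw [Homotopic.Quotient.symm_of_trans, Homotopic.Quotient.trans_assoc, ← Homotopic.Quotient.trans_assoc (C.pathIn b hb _),
    Homotopic.Quotient.trans_symm, Homotopic.Quotient.refl_trans]

theorem loop_self (a : ι) : C.loop o a a = .refl _ :=
  Homotopic.Quotient.trans_symm _

theorem loop_symm (a b : ι) : (C.loop o a b).symm = C.loop o b a := by
  rw [loop, Homotopic.Quotient.symm_of_trans, Homotopic.Quotient.symm_symm, pathTo_trans_symm]

/-- The edges at `o` form the spanning tree along which `pathTo` runs, so their loops are trivial.
-/
theorem loop_base_left (a : ι) : C.loop o o a = .refl _ := by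
  rw [← C.pathTo_trans_symm o (C.point_mem_left o a) (C.point_mem_right o a), pathTo_base, pathTo,
    pathIn_self, Homotopic.Quotient.trans_refl, Homotopic.Quotient.trans_symm]

theorem loop_base_right (a : ι) : C.loop o a o = .refl _ := by
  rw [← loop_symm, loop_base_left]
  rfl

theorem joined_point (x : X) : Joined (C.point o o) x := by
  obtain ⟨a, ha⟩ := C.exists_mem x
  obtain ⟨p, -⟩ := Homotopic.Quotient.mk_surjective (C.pathTo o a ha)
  exact ⟨p⟩

theorem pathConnectedSpace {X ι : Type*} [TopologicalSpace X] [Nonempty ι]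
    (C : CompleteGraphCover X ι) : PathConnectedSpace X :=
  let o := Classical.arbitrary ι
  ⟨⟨C.point o o⟩, fun x y => (C.joined_point o x).symm.trans (C.joined_point o y)⟩

/-- A class of paths from `C.set a` to `C.set b`, closed up through the base point. -/
noncomputable def close (a b : ι) {x y : X} (ha : x ∈ C.set a) (hb : y ∈ C.set b)
    (γ : Homotopic.Quotient x y) : FundamentalGroup X (C.point o o) :=
  ((C.pathTo o a ha).trans γ).trans (C.pathTo o b hb).symm

theorem close_trans {a b c : ι} {x y z : X} (ha : x ∈ C.set a) (hb : y ∈ C.set b)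
    (hc : z ∈ C.set c) (γ : Homotopic.Quotient x y) (γ' : Homotopic.Quotient y z) :
    C.close o a c ha hc (γ.trans γ') = C.close o b c hb hc γ' * C.close o a b ha hb γ := by
  rw [FundamentalGroup.mul_def]
  simp only [close, Homotopic.Quotient.trans_assoc]
  rw [← Homotopic.Quotient.trans_assoc (C.pathTo o b hb).symm, Homotopic.Quotient.symm_trans, Homotopic.Quotient.refl_trans]

theorem close_mk_of_forall_mem {a : ι} {x y : X} {p : Path x y} (hp : ∀ t, p t ∈ C.set a)
    (hx : x ∈ C.set a) (hy : y ∈ C.set a) : C.close o a a hx hy (.mk p) = 1 := by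
  rw [close, C.mk_eq_pathIn hp hx hy, pathTo_trans_pathIn, Homotopic.Quotient.trans_symm,
    FundamentalGroup.one_def]

variable [LinearOrder ι]

/-- The edges outside the star of `o` in the complete graph with vertices `ι`. -/
abbrev NonStarEdge (o : ι) : Type _ := {p : ι × ι // p.1 < p.2 ∧ p.1 ≠ o ∧ p.2 ≠ o}

open Classical in
/-- The generator of the free group that belongs to the oriented edge from `a` to `b`. -/
noncomputable def edgeGenerator (a b : ι) : FreeGroup (NonStarEdge o) :=
  if h : a < b ∧ a ≠ o ∧ b ≠ o then .of ⟨(a, b), h⟩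
  else if h : b < a ∧ b ≠ o ∧ a ≠ o then (.of ⟨(b, a), h⟩)⁻¹ else 1

theorem edgeGenerator_self (a : ι) : edgeGenerator o a a = 1 := by
  simp [edgeGenerator]

theorem edgeGenerator_base_left (a : ι) : edgeGenerator o o a = 1 := by
  simp [edgeGenerator]

theorem edgeGenerator_mul_swap (a b : ι) : edgeGenerator o b a * edgeGenerator o a b = 1 := by
  unfold edgeGenerator
  split_ifs with h h' h'
  · exact absurd h.1 h'.1.asymm
  all_goals simp

theorem edgeGenerator_of_edge (e : NonStarEdge o) :
    edgeGenerator o e.1.1 e.1.2 = .of e := by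
  simp [edgeGenerator, e.2]

/-- The homomorphism that sends the generator of an edge to the loop along that edge. -/
noncomputable def freeGroupHom : FreeGroup (NonStarEdge o) →* FundamentalGroup X (C.point o o) :=
  FreeGroup.lift fun e => C.loop o e.1.1 e.1.2

theorem freeGroupHom_edgeGenerator (a b : ι) :
    C.freeGroupHom o (edgeGenerator o a b) = C.loop o a b := by
  unfold edgeGenerator
  split_ifs with h h'
  · simp [freeGroupHom]
  · simp only [freeGroupHom, map_inv, FreeGroup.lift_apply_of]
    exact C.loop_symm o b a
  · rw [map_one, FundamentalGroup.one_def]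
    by_cases ha : a = o
    · rw [ha, loop_base_left]
    by_cases hb : b = o
    · rw [hb, loop_base_right]
    have : a = b := by grind
    rw [this, loop_self]

/-- The cocycle of the cover whose holonomy along loops inverts `freeGroupHom`. -/
noncomputable def cocycle : ConstantCocycle X ι (FreeGroup (NonStarEdge o)) where
  set := C.set
  isOpen_set := C.isOpen_set
  index x := (C.exists_mem x).choose
  mem_index x := (C.exists_mem x).choose_spec
  change := edgeGenerator o
  change_mul a b c h := by
    -- Without triple intersections the cocycle condition is needed only when two indices agree, so
    -- the generators may be chosen freely.
    rcases C.eq_of_mem a b c h with rfl | rfl | rfl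
    · rw [edgeGenerator_self, mul_one]
    · rw [edgeGenerator_self, one_mul]
    · rw [edgeGenerator_mul_swap, edgeGenerator_self]

section Holonomy

variable [TopologicalSpace (FreeGroup (NonStarEdge o))]
  [DiscreteTopology (FreeGroup (NonStarEdge o))]

theorem hasHolonomy_pathIn {a : ι} {x y : X} (hx : x ∈ C.set a) (hy : y ∈ C.set a) :
    (C.cocycle o).HasHolonomy (C.pathIn a hx hy) a a 1 := by
  obtain ⟨p, hp, h⟩ := C.exists_pathIn_eq hx hy
  exact h ▸ (C.cocycle o).hasHolonomy_of_forall_mem hp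

/-- The only change of trivialization is from `o` to `a`, along a tree edge, where the cocycle is
trivial. -/
theorem hasHolonomy_pathTo {a : ι} {x : X} (hx : x ∈ C.set a) :
    (C.cocycle o).HasHolonomy (C.pathTo o a hx) o a 1 := by
  have h := (C.cocycle o).hasHolonomy_refl (C.point_mem_left o a) (C.point_mem_right o a)
  have h' := ((C.hasHolonomy_pathIn o (C.point_mem_left o o) (C.point_mem_left o a)).trans _
    h).trans _ (C.hasHolonomy_pathIn o (C.point_mem_right o a) hx)
  rw [Homotopic.Quotient.trans_refl] at h'
  rw [pathTo]
  convert h' using 1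
  simp [cocycle, edgeGenerator_base_left]

theorem hasHolonomy_loop (a b : ι) :
    (C.cocycle o).HasHolonomy (C.loop o a b) o o (edgeGenerator o a b) := by
  have h := ((C.hasHolonomy_pathTo o (C.point_mem_left a b)).trans _
    ((C.cocycle o).hasHolonomy_refl (C.point_mem_left a b) (C.point_mem_right a b))).trans _
    (C.hasHolonomy_pathTo o (C.point_mem_right a b)).symm
  rw [Homotopic.Quotient.trans_refl, inv_one, one_mul, mul_one] at h
  exact h

theorem hasHolonomy_freeGroupHom (w : FreeGroup (NonStarEdge o)) :
    (C.cocycle o).HasHolonomy (C.freeGroupHom o w) o o w := by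
  induction w using FreeGroup.induction_on with
  | C1 =>
    rw [map_one, ← edgeGenerator_self o o]
    exact (C.cocycle o).hasHolonomy_refl (C.point_mem_left o o) (C.point_mem_left o o)
  | of e =>
    have h := C.hasHolonomy_loop o e.1.1 e.1.2
    rw [← freeGroupHom_edgeGenerator, edgeGenerator_of_edge] at h
    exact h
  | inv_of e h =>
    rw [map_inv]
    exact h.symm
  | mul v w hv hw =>
    rw [map_mul]
    -- The product `v * w` in the fundamental group is the path `w` followed by `v`, which matches
    -- the order in `HasHolonomy.trans`.
    exact hw.trans _ hv

end Holonomy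

theorem freeGroupHom_injective : Function.Injective (C.freeGroupHom o) := by
  let _ : TopologicalSpace (FreeGroup (NonStarEdge o)) := ⊥
  have : DiscreteTopology (FreeGroup (NonStarEdge o)) := ⟨rfl⟩
  intro v w h
  have hv := C.hasHolonomy_freeGroupHom o v
  rw [h] at hv
  exact hv.unique _ (C.hasHolonomy_freeGroupHom o w)

theorem close_refl {a b : ι} {x : X} (ha : x ∈ C.set a) (hb : x ∈ C.set b) :
    C.close o a b ha hb (.refl x) = C.freeGroupHom o (edgeGenerator o a b) := by
  rw [close, Homotopic.Quotient.trans_refl, pathTo_trans_symm, freeGroupHom_edgeGenerator]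

/-- Cut the path into pieces that each lie in one set of the cover. Closed up, a piece is trivial,
and each change of set at a cut contributes the image of an edge generator. -/
theorem close_mk_mem_range {a b : ι} {x y : X} (ha : x ∈ C.set a) (hb : y ∈ C.set b)
    (p : Path x y) : C.close o a b ha hb (.mk p) ∈ (C.freeGroupHom o).range := by
  have hrefl : ∀ {a b : ι} {x : X} (ha : x ∈ C.set a) (hb : x ∈ C.set b),
      C.close o a b ha hb (.refl x) ∈ (C.freeGroupHom o).range := fun ha hb =>
    ⟨_, (C.close_refl o ha hb).symm⟩
  obtain ⟨t, ht0, hmono, ⟨N, hN⟩, hsub⟩ := exists_monotone_Icc_subset_open_cover_unitInterval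
    (c := fun a => p ⁻¹' C.set a) (fun a => (C.isOpen_set a).preimage p.continuous)
    (fun s _ => Set.mem_iUnion.2 (C.exists_mem (p s)))
  have hp0 : p 0 ∈ C.set a := by rwa [p.source]
  -- The index `c` stays arbitrary, because the set containing the next piece is chosen only in the
  -- induction step.
  have key : ∀ n c (hc : p (t n) ∈ C.set c),
      C.close o a c hp0 hc (.mk (p.subpath 0 (t n))) ∈ (C.freeGroupHom o).range := by
    intro n
    induction n with
    | zero =>
      rw [ht0]
      intro c hc
      rw [Path.subpath_self, Homotopic.Quotient.mk_refl]
      exact hrefl _ _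
    | succ n ih =>
      intro c hc
      obtain ⟨d, hd⟩ := hsub n
      have hle := hmono n.le_succ
      have hn : p (t n) ∈ C.set d := hd ⟨le_rfl, hle⟩
      have hn' : p (t (n + 1)) ∈ C.set d := hd ⟨hle, le_rfl⟩
      have hstep : C.close o d d hn hn' (.mk (p.subpath (t n) (t (n + 1)))) = 1 := by
        refine C.close_mk_of_forall_mem o (fun s => ?_) hn hn'
        have hs : p.subpath (t n) (t (n + 1)) s ∈ Set.range (p.subpath (t n) (t (n + 1))) :=
          Set.mem_range_self s
        rw [Path.range_subpath_of_le _ _ _ hle] at hs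
        obtain ⟨r, hr, hrs⟩ := hs
        exact hrs ▸ hd hr
      -- The final constant path accommodates the change of set from `d` to `c`.
      have hcomp : Homotopic.Quotient.mk (p.subpath 0 (t (n + 1))) =
          ((Homotopic.Quotient.mk (p.subpath 0 (t n))).trans (.mk (p.subpath (t n) (t (n + 1))))).trans
            (.refl _) := by
        rw [Homotopic.Quotient.trans_refl, ← Homotopic.Quotient.mk_trans]
        exact (Homotopic.Quotient.eq.2 ⟨Path.Homotopy.subpathTransSubpath p 0 (t n) (t (n + 1))⟩).symm
      rw [hcomp, C.close_trans o hp0 hn' hc, C.close_trans o hp0 hn hn', hstep, one_mul]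
      exact mul_mem (hrefl _ _) (ih d hn)
  have hp1 : p 1 ∈ C.set b := by rwa [p.target]
  have h1 : C.close o a b hp0 hp1 (.mk (p.subpath 0 1)) ∈ (C.freeGroupHom o).range := by
    have := key N
    rw [hN N le_rfl] at this
    exact this b hp1
  rw [Path.subpath_zero_one] at h1
  obtain ⟨f, rfl, rfl⟩ := p
  exact h1

theorem freeGroupHom_surjective : Function.Surjective (C.freeGroupHom o) := by
  intro γ
  obtain ⟨p, rfl⟩ := Homotopic.Quotient.mk_surjective γ
  have h := C.close_mk_mem_range o (C.point_mem_left o o) (C.point_mem_left o o) p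
  rw [close, pathTo_base, pathIn_self, Homotopic.Quotient.refl_trans,
    ← Homotopic.Quotient.mk_refl, ← Homotopic.Quotient.mk_symm, Path.refl_symm,
    Homotopic.Quotient.mk_refl, Homotopic.Quotient.trans_refl] at h
  exact h

/-- The fundamental group of a space with a cover whose nerve is a complete graph. -/
theorem nonempty_fundamentalGroup_mulEquiv {X ι : Type*} [TopologicalSpace X] [LinearOrder ι]
    (C : CompleteGraphCover X ι) (o : ι) (x : X) :
    Nonempty (FundamentalGroup X x ≃* FreeGroup (NonStarEdge o)) :=
  have : Nonempty ι := ⟨o⟩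
  have := C.pathConnectedSpace
  ⟨(FundamentalGroup.fundamentalGroupMulEquivOfPathConnected x (C.point o o)).trans
    (MulEquiv.ofBijective (C.freeGroupHom o)
      ⟨C.freeGroupHom_injective o, C.freeGroupHom_surjective o⟩).symm⟩

end CompleteGraphCover

/-! ### Classification of the admissible graphs of rank one with two legs. -/

namespace LegGraph

variable {V E V' E' : Type*} {s : ℕ}

theorem joined_of_mem {G : LegGraph V E s} {F : Set E} {e : E} (he : e ∈ F) {u v : V}
    (h : G.ends e = s(u, v)) : (G.joined F).r u v :=
  Relation.EqvGen.rel _ _ ⟨e, he, h⟩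

theorem eq_of_joined_of_forall_isDiag {G : LegGraph V E s} {F : Set E}
    (hF : ∀ e ∈ F, (G.ends e).IsDiag) {u v : V} (h : (G.joined F).r u v) : u = v := by
  induction h with
  | rel u v h =>
    obtain ⟨e, he, h⟩ := h
    simpa [h] using hF e he
  | refl => rfl
  | symm _ _ _ ih => exact ih.symm
  | trans _ _ _ _ _ ih ih' => exact ih.trans ih'

theorem ConnectedOn.exists_not_isDiag [Nontrivial V] {G : LegGraph V E s} {F : Set E}
    (h : G.ConnectedOn F) : ∃ e ∈ F, ¬ (G.ends e).IsDiag := by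
  by_contra! hF
  obtain ⟨u, v, huv⟩ := exists_pair_ne V
  exact huv (eq_of_joined_of_forall_isDiag hF (h.2 u v))

theorem ConnectedOn.subsingleton_components {G : LegGraph V E s} {F : Set E}
    (h : G.ConnectedOn F) : Subsingleton (G.Components F) :=
  ⟨fun p q => Quotient.inductionOn₂ p q fun u v => Quotient.sound (h.2 u v)⟩

theorem ConnectedOn.card_components {G : LegGraph V E s} {F : Set E}
    (h : G.ConnectedOn F) : Nat.card (G.Components F) = 1 :=
  Nat.card_eq_one_iff_unique.2 ⟨h.subsingleton_components, h.1.map (Quotient.mk (G.joined F))⟩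

theorem card_components_empty (G : LegGraph V E s) : Nat.card (G.Components ∅) = Nat.card V := by
  refine (Nat.card_congr (Equiv.ofBijective (Quotient.mk (G.joined ∅)) ⟨fun u v h => ?_,
    Quotient.mk_surjective⟩)).symm
  exact eq_of_joined_of_forall_isDiag (by simp) (Quotient.exact h)

theorem sum_valency {p q s : ℕ} (G : LegGraph (Fin p) (Fin q) s) :
    ∑ v, G.valency v = 2 * q + s := by
  classical
  have hval : ∀ v, G.valency v = ∑ e, ((if v ∈ G.ends e then 1 else 0) +
      if G.ends e = s(v, v) then 1 else 0) + ∑ i, if G.leg i = v then 1 else 0 := fun v => by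
    simp only [valency, Set.ncard_eq_toFinset_card', Set.toFinset_ofPred, Finset.card_filter,
      Finset.sum_add_distrib]
  -- A non-loop contributes one at each of its two ends; a loop contributes twice at its only
  -- vertex.
  have hedge : ∀ z : Sym2 (Fin p), ∑ v, ((if v ∈ z then 1 else 0) +
      if z = s(v, v) then 1 else 0) = 2 := fun z => by
    induction z with | _ x y
    rw [Finset.sum_add_distrib, ← Finset.card_filter, ← Finset.card_filter]
    by_cases hxy : x = y
    · subst hxy
      simp [Finset.filter_eq, Finset.filter_eq']
    · have h1 : Finset.univ.filter (fun v => v ∈ s(x, y)) = {x, y} := by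
        ext v; simp
      have h2 : Finset.univ.filter (fun v => s(x, y) = s(v, v)) = ∅ := by
        ext v
        simp only [Finset.mem_filter, Finset.mem_univ, true_and, Finset.notMem_empty, iff_false]
        intro h
        have : (s(x, y)).IsDiag := h ▸ Sym2.diag_isDiag v
        exact hxy (by simpa using this)
      rw [h1, h2, Finset.card_pair hxy, Finset.card_empty]
  simp only [hval]
  rw [Finset.sum_add_distrib, Finset.sum_comm]
  simp only [hedge]
  rw [Finset.sum_comm]
  simp [mul_comm]

theorem IsAdmissible.card_vertices_le {p q s : ℕ} {G : LegGraph (Fin p) (Fin q) s}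
    (h : G.IsAdmissible) : 3 * p ≤ 2 * q + s := by
  rw [← G.sum_valency]
  calc 3 * p = ∑ _v : Fin p, 3 := by simp [mul_comm]
    _ ≤ _ := Finset.sum_le_sum fun v _ => h.2 v

theorem IsAdmissible.rank_eq {p q s : ℕ} {G : LegGraph (Fin p) (Fin q) s}
    (h : G.IsAdmissible) : G.rank = q - p + 1 := by
  rw [rank, rankOn, h.1.1.card_components, Set.ncard_univ]
  simp

/-- Removing one edge leaves the other to connect both vertices, so neither is a loop. If both legs
were at one vertex, the other vertex would have valency two. In `Fin 2`, `1 - e` is the element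
other than `e`. -/
theorem IsAdmissible.leg_ne {G : LegGraph (Fin 2) (Fin 2) 2} (h : G.IsAdmissible) :
    (∀ e, ¬ (G.ends e).IsDiag) ∧ G.leg 0 ≠ G.leg 1 := by
  have hdiag : ∀ e, ¬ (G.ends e).IsDiag := fun e => by
    obtain ⟨e', he', hd⟩ := (h.1.2 (1 - e)).exists_not_isDiag
    have : e' = e := by
      simp only [Set.mem_compl_iff, Set.mem_singleton_iff] at he'
      omega
    rwa [← this]
  refine ⟨hdiag, fun hleg => ?_⟩
  have h3 := h.2 (1 - G.leg 0)
  have h1 : {e | G.ends e = s(1 - G.leg 0, 1 - G.leg 0)} = ∅ :=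
    Set.eq_empty_of_forall_notMem fun e he => hdiag e (he ▸ Sym2.diag_isDiag _)
  have h2 : {i | G.leg i = 1 - G.leg 0} = ∅ :=
    Set.eq_empty_of_forall_notMem fun i hi => by
      simp only [Set.mem_ofPred_eq] at hi
      have : G.leg i = G.leg 0 := by
        fin_cases i
        exacts [rfl, hleg.symm]
      omega
  have h4 : {e | 1 - G.leg 0 ∈ G.ends e}.ncard ≤ 2 := by
    simpa using Set.ncard_le_card {e | 1 - G.leg 0 ∈ G.ends e}
  rw [valency, h1, h2, Set.ncard_empty] at h3
  omega

theorem IsAdmissible.ends_eq {G : LegGraph (Fin 2) (Fin 2) 2} (h : G.IsAdmissible) (e : Fin 2) :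
    G.ends e = s(G.leg 0, G.leg 1) := by
  obtain ⟨hd, hl⟩ := h.leg_ne
  have := hd e
  generalize G.ends e = z at this ⊢
  induction z with | _ x y
  rw [Sym2.mk_isDiag_iff] at this
  rw [Sym2.eq_iff]
  omega

namespace Iso

theorem joined_map {G : LegGraph V E s} {G' : LegGraph V' E' s} (φ : Iso G G') {Z : Set E}
    {Z' : Set E'} (h : ∀ e ∈ Z, φ.edgeEquiv e ∈ Z') {u v : V} (huv : (G.joined Z).r u v) :
    (G'.joined Z').r (φ.vertexEquiv u) (φ.vertexEquiv v) := by
  induction huv with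
  | rel u v huv =>
    obtain ⟨e, he, hends⟩ := huv
    exact joined_of_mem (h e he) (by rw [φ.ends_map, hends]; rfl)
  | refl u => exact (G'.joined Z').refl _
  | symm _ _ _ ih => exact (G'.joined Z').symm ih
  | trans _ _ _ _ _ ih ih' => exact (G'.joined Z').trans ih ih'

/-- An isomorphism of graphs induces an isomorphism after collapsing corresponding edges. -/
def contract {G : LegGraph V E s} {G' : LegGraph V' E' s} (φ : Iso G G') {Z : Set E}
    {Z' : Set E'} (h : ∀ e, e ∈ Z ↔ φ.edgeEquiv e ∈ Z') : Iso (G.contract Z) (G'.contract Z') where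
  vertexEquiv := Quotient.congr φ.vertexEquiv fun u v =>
    ⟨φ.joined_map fun e he => (h e).1 he, fun huv => by
      have := φ.symm.joined_map (Z := Z') (Z' := Z)
        (fun e he => (h _).2 (by rwa [symm, Equiv.apply_symm_apply])) huv
      simpa [symm] using this⟩
  edgeEquiv := φ.edgeEquiv.subtypeEquiv fun e => not_congr (h e)
  ends_map e := by
    simp only [LegGraph.contract, Equiv.subtypeEquiv_apply, φ.ends_map]
    generalize G.ends e = z
    induction z with | _ x y
    rfl
  leg_map i := by
    simp only [LegGraph.contract, φ.leg_map]
    rfl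

/-- Two graphs with one vertex and one edge are isomorphic. -/
def ofUnique [Unique V] [Unique E] [Unique V'] [Unique E'] (G : LegGraph V E s)
    (G' : LegGraph V' E' s) : Iso G G' where
  vertexEquiv := Equiv.ofUnique V V'
  edgeEquiv := Equiv.ofUnique E E'
  ends_map _ := Subsingleton.elim _ _
  leg_map _ := Subsingleton.elim _ _

end Iso

/-- The graph with two parallel edges whose end points carry one leg each. -/
def theta : LegGraph (Fin 2) (Fin 2) 2 where
  ends _ := s(0, 1)
  leg i := i

theorem theta_connectedOn {F : Set (Fin 2)} {e : Fin 2} (he : e ∈ F) : theta.ConnectedOn F := by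
  have h : (theta.joined F).r 0 1 := joined_of_mem he rfl
  refine ⟨⟨0⟩, fun u v => ?_⟩
  fin_cases u <;> fin_cases v
  exacts [(theta.joined F).refl _, h, (theta.joined F).symm h, (theta.joined F).refl _]

theorem theta_isAdmissible : theta.IsAdmissible := by
  refine ⟨⟨theta_connectedOn (Set.mem_univ 0), fun e => theta_connectedOn (e := 1 - e) ?_⟩,
    fun v => ?_⟩
  · simp only [Set.mem_compl_iff, Set.mem_singleton_iff]
    omega
  · have h1 : {e | v ∈ theta.ends e} = Set.univ := by
      ext e
      fin_cases v <;> simp [theta]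
    have h2 : {i | theta.leg i = v} = {v} := by
      ext i
      simp [theta]
    rw [valency, h1, h2]
    simp only [Set.ncard_univ, Nat.card_eq_fintype_card, Fintype.card_fin, Set.ncard_singleton]
    omega

theorem theta_isForest {F : Set (Fin 2)} (hF : F ≠ Set.univ) : theta.IsForest F := by
  rw [IsForest, rankOn]
  rcases F.eq_empty_or_nonempty with rfl | ⟨e, he⟩
  · rw [card_components_empty]
    simp
  · have : F = {e} := by
      refine (Set.eq_singleton_iff_unique_mem).2 ⟨he, fun e' he' => ?_⟩
      by_contra hne
      refine hF (Set.eq_univ_of_forall fun f => ?_)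
      have : f = e ∨ f = e' := by omega
      rcases this with rfl | rfl <;> assumption
    rw [(theta_connectedOn he).card_components, this, Set.ncard_singleton]
    simp

end LegGraph

/-! ### Equivalences of colored metric graphs and reduction to theta graphs. -/

namespace ColoredMetricGraph

variable {m n s : ℕ}

theorem Equivalent.of_iso {x y : ColoredMetricGraph m n s}
    (φ : LegGraph.Iso x.1.graph y.1.graph)
    (h : ∀ e, y.2.1 (φ.edgeEquiv e) = x.2.1 e ∧ y.1.color (φ.edgeEquiv e) = x.1.color e) :
    Equivalent x y :=
  ⟨φ.contract fun e => by simp only [zeroEdges, Set.mem_ofPred_eq, h], fun e => h e.1⟩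

/-- Both graphs collapse to a single vertex with one loop, so only the length and color of that loop
remain. -/
theorem Equivalent.of_single {x y : ColoredMetricGraph m n s}
    (hx : x.1.graph.ConnectedOn x.zeroEdges) (hy : y.1.graph.ConnectedOn y.zeroEdges)
    {e : Fin x.1.numE} {e' : Fin y.1.numE} (he : ∀ f, x.2.1 f ≠ 0 ↔ f = e)
    (he' : ∀ f, y.2.1 f ≠ 0 ↔ f = e') (hlength : y.2.1 e' = x.2.1 e)
    (hcolor : y.1.color e' = x.1.color e) : Equivalent x y := by
  have := hx.subsingleton_components
  have := hy.subsingleton_components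
  let _ : Unique (x.1.graph.Components x.zeroEdges) :=
    @Unique.mk' _ ⟨Quotient.mk _ hx.1.some⟩ _
  let _ : Unique (y.1.graph.Components y.zeroEdges) :=
    @Unique.mk' _ ⟨Quotient.mk _ hy.1.some⟩ _
  let _ : Unique {f // f ∉ x.zeroEdges} :=
    ⟨⟨⟨e, (he e).2 rfl⟩⟩, fun f => Subtype.ext ((he f.1).1 f.2)⟩
  let _ : Unique {f // f ∉ y.zeroEdges} :=
    ⟨⟨⟨e', (he' e').2 rfl⟩⟩, fun f => Subtype.ext ((he' f.1).1 f.2)⟩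
  refine ⟨LegGraph.Iso.ofUnique _ _, fun f => ?_⟩
  have h1 : f.1 = e := (he f.1).1 f.2
  have h2 : ((LegGraph.Iso.ofUnique (x.1.graph.contract x.zeroEdges)
    (y.1.graph.contract y.zeroEdges)).edgeEquiv f).1 = e' := rfl
  rw [h1, h2]
  exact ⟨hlength, hcolor⟩

/-- Collapsed edges contribute zero. This is the source of all the invariants in `coord`. -/
theorem Equivalent.sum_eq {x y : ColoredMetricGraph m n s} (h : Equivalent x y)
    (F : Fin m → ℝ → ℝ) (hF : ∀ c, F c 0 = 0) :
    ∑ e, F (x.1.color e) (x.2.1 e) = ∑ e, F (y.1.color e) (y.2.1 e) := by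
  classical
  have key : ∀ z : ColoredMetricGraph m n s, ∑ e, F (z.1.color e) (z.2.1 e) =
      ∑ e : {e // e ∉ z.zeroEdges}, F (z.1.color e.1) (z.2.1 e.1) := fun z => by
    rw [← Finset.sum_subtype (Finset.univ.filter fun e => e ∉ z.zeroEdges) (by simp)
      (fun e => F (z.1.color e) (z.2.1 e))]
    refine (Finset.sum_filter_of_ne (p := fun e => e ∉ z.zeroEdges) fun e _ hne h0 => hne ?_).symm
    rw [show z.2.1 e = 0 from h0, hF]
  obtain ⟨φ, hφ⟩ := h
  rw [key, key, ← Equiv.sum_comp φ.edgeEquiv]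
  exact Finset.sum_congr rfl fun e _ => by rw [(hφ e).1, (hφ e).2]

end ColoredMetricGraph

/-- The coloring of the theta graph by `a` and `b`. -/
def ColoredGraph.theta {m : ℕ} (a b : Fin m) : ColoredGraph m 1 2 where
  numV := 2
  numE := 2
  graph := LegGraph.theta
  admissible := LegGraph.theta_isAdmissible
  rank_eq := by simp [LegGraph.theta_isAdmissible.rank_eq]
  color := ![a, b]

namespace ColoredMetricGraph

variable {m : ℕ}

/-- The theta graph with edges of length `t` and `1 - t` and colors `a` and `b`. -/
def theta (a b : Fin m) (t : unitInterval) : ColoredMetricGraph m 1 2 :=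
  ⟨ColoredGraph.theta a b, ![(t : ℝ), 1 - t],
    fun e => by
      change Fin 2 at e
      fin_cases e
      exacts [t.2.1, sub_nonneg.2 t.2.2],
    by
      change ∑ e : Fin 2, ![(t : ℝ), 1 - t] e = 1
      simp,
    LegGraph.theta_isForest fun h => by
      have h0 : (0 : Fin 2) ∈ {e : Fin 2 | ![(t : ℝ), 1 - t] e = 0} := h ▸ Set.mem_univ _
      have h1 : (1 : Fin 2) ∈ {e : Fin 2 | ![(t : ℝ), 1 - t] e = 0} := h ▸ Set.mem_univ _
      simp only [Set.mem_ofPred_eq, Matrix.cons_val_zero, Matrix.cons_val_one] at h0 h1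
      linarith⟩

theorem continuous_theta (a b : Fin m) : Continuous (theta a b) := by
  refine continuous_sigmaMk.comp (Continuous.subtype_mk (continuous_pi fun e => ?_) _)
  change Fin 2 at e
  fin_cases e
  · exact continuous_subtype_val
  · exact continuous_const.sub continuous_subtype_val

theorem theta_swap (a b : Fin m) (t : unitInterval) :
    Equivalent (theta a b t) (theta b a (unitInterval.symm t)) := by
  let φ : LegGraph.Iso LegGraph.theta LegGraph.theta :=
    ⟨Equiv.refl _, Equiv.swap 0 1, fun _ => rfl, fun _ => rfl⟩
  refine Equivalent.of_iso (x := theta a b t) (y := theta b a (unitInterval.symm t)) φ fun e => ?_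
  change Fin 2 at e
  fin_cases e
  · exact ⟨sub_sub_cancel _ _, rfl⟩
  · exact ⟨rfl, rfl⟩

theorem theta_zero_connectedOn (a b : Fin m) :
    (theta a b 0).1.graph.ConnectedOn (theta a b 0).zeroEdges ∧
      ∀ f : Fin 2, (theta a b 0).2.1 f ≠ 0 ↔ f = 1 := by
  refine ⟨LegGraph.theta_connectedOn (e := 0) rfl, fun f => ?_⟩
  fin_cases f
  · simp [theta]
  · simp [theta]

/-- The first edge is collapsed, and its color is forgotten with it. -/
theorem theta_zero (a a' b : Fin m) : Equivalent (theta a b 0) (theta a' b 0) :=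
  Equivalent.of_single (theta_zero_connectedOn a b).1 (theta_zero_connectedOn a' b).1 (theta_zero_connectedOn a b).2
    (theta_zero_connectedOn a' b).2 rfl rfl

theorem exists_equivalent_theta (x : ColoredMetricGraph m 1 2) :
    ∃ a b t, Equivalent x (theta a b t) := by
  obtain ⟨⟨p, q, G, hG, hrank, c⟩, l, hl0, hl1, hforest⟩ := x
  dsimp only at l hl0 hl1 hforest
  have hr := hG.rank_eq
  rw [hrank] at hr
  have hle := hG.card_vertices_le
  have hpos : 0 < p := Fin.pos_iff_nonempty.2 hG.1.1.1
  have hqp : q = p := by push_cast at hr; omega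
  subst hqp
  have hcases : q = 1 ∨ q = 2 := by omega
  rcases hcases with rfl | rfl
  · have hl : l 0 = 1 := by simpa using hl1
    -- The loop is the second edge of a theta graph whose first edge has length zero; the first
    -- color is immaterial.
    refine ⟨c 0, c 0, 0, Equivalent.of_single (e := (0 : Fin 1)) (e' := (1 : Fin 2)) ?_
      (theta_zero_connectedOn _ _).1 ?_ (theta_zero_connectedOn _ _).2 ?_ rfl⟩
    · exact ⟨⟨(0 : Fin 1)⟩, fun u v => by
        rw [Subsingleton.elim (α := Fin 1) u v]⟩
    · intro f
      have hf : f = (0 : Fin 1) := Subsingleton.elim (α := Fin 1) _ _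
      subst hf
      simp [hl]
    · simp [theta, hl]
  · have hsum : l 0 + l 1 = 1 := by simpa using hl1
    have hinj : Function.Injective G.leg := fun i j hij => by
      have := hG.leg_ne.2
      fin_cases i <;> fin_cases j
      exacts [rfl, absurd hij this, absurd hij.symm this, rfl]
    let t : unitInterval := ⟨l 0, hl0 0, by linarith [hl0 1]⟩
    refine ⟨c 0, c 1, t, equivalence.symm (Equivalent.of_iso (x := theta (c 0) (c 1) t)
      ⟨Equiv.ofBijective G.leg (Finite.injective_iff_bijective.1 hinj), Equiv.refl (Fin 2),
        fun e => hG.ends_eq e, fun i => rfl⟩ fun e => ?_)⟩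
    change Fin 2 at e
    fin_cases e
    · exact ⟨rfl, rfl⟩
    · exact ⟨eq_sub_of_add_eq' hsum, rfl⟩

end ColoredMetricGraph

/-! ### Invariant coordinates. -/

namespace ColoredMetricGraph

variable {m n s : ℕ}

/-- The total length of the edges of color `c`. -/
noncomputable def colorLength (x : ColoredMetricGraph m n s) (c : Fin m) : ℝ :=
  ∑ e, if x.1.color e = c then x.2.1 e else 0

/-- The color lengths, and the excess of the sum of their squares over the sum of the squares
of the edge lengths. -/
noncomputable def coord (x : ColoredMetricGraph m n s) : (Fin m → ℝ) × ℝ :=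
  (x.colorLength, ∑ c, x.colorLength c ^ 2 - ∑ e, x.2.1 e ^ 2)

theorem Equivalent.coord_eq {x y : ColoredMetricGraph m n s} (h : Equivalent x y) :
    x.coord = y.coord := by
  have h1 : x.colorLength = y.colorLength :=
    funext fun c => h.sum_eq (fun d l => if d = c then l else 0) (by simp)
  have h2 := h.sum_eq (fun _ l => l ^ 2) (by simp)
  rw [coord, coord, h1, h2]

theorem continuous_coord : Continuous (coord : ColoredMetricGraph m n s → _) := by
  refine continuous_sigma fun Γ => ?_
  have hl : ∀ e, Continuous fun l : Γ.RegularMetric => l.1 e := fun e =>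
    (continuous_apply e).comp continuous_subtype_val
  have hc : ∀ c, Continuous fun l : Γ.RegularMetric => colorLength ⟨Γ, l⟩ c := fun c => by
    change Continuous fun l : Γ.RegularMetric => ∑ e, if Γ.color e = c then l.1 e else 0
    refine continuous_finsetSum _ fun e _ => ?_
    by_cases h : Γ.color e = c
    · simpa only [h, if_true] using hl e
    · simpa only [h, if_false] using continuous_const
  have hq : Continuous fun l : Γ.RegularMetric => ∑ e, l.1 e ^ 2 :=
    continuous_finsetSum _ fun e _ => (hl e).pow 2
  exact (continuous_pi hc).prodMk ((continuous_finsetSum _ fun c _ => (hc c).pow 2).sub hq)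

theorem coord_theta (a b : Fin m) (t : unitInterval) :
    (theta a b t).coord = ((t : ℝ) • Pi.single a 1 + (1 - t : ℝ) • Pi.single b 1,
      if a = b then 2 * (t : ℝ) * (1 - t) else 0) := by
  have h1 : ∀ c, (theta a b t).colorLength c =
      (if a = c then (t : ℝ) else 0) + if b = c then (1 - t : ℝ) else 0 := fun c => by
    change ∑ e : Fin 2, (if ![a, b] e = c then ![(t : ℝ), 1 - t] e else 0) = _
    rw [Fin.sum_univ_two]
    rfl
  refine Prod.ext (funext fun c => ?_) ?_
  · change (theta a b t).colorLength c = _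
    simp [h1, Pi.single_apply, eq_comm]
  · change ∑ c, (theta a b t).colorLength c ^ 2 - ∑ e : Fin 2, ![(t : ℝ), 1 - t] e ^ 2 = _
    simp only [h1, add_sq, Finset.sum_add_distrib, ite_pow, mul_assoc, ite_mul, zero_mul, mul_ite,
      mul_zero]
    by_cases hab : a = b
    · subst hab
      simp [Finset.sum_ite_eq]
    · simp [Finset.sum_ite_eq, hab]

end ColoredMetricGraph

/-! ### Embedding of the moduli space and its cover by open stars. -/

namespace MCG

variable {m : ℕ}

/-- The point of the moduli space given by the theta graph with edges of length `t` and `1 - t`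
and colors `a` and `b`. -/
def theta (a b : Fin m) (t : unitInterval) : MCG m 1 2 :=
  Quotient.mk (ColoredMetricGraph.setoid m 1 2) (ColoredMetricGraph.theta a b t)

theorem continuous_theta (a b : Fin m) : Continuous (theta a b) :=
  continuous_quotient_mk'.comp (ColoredMetricGraph.continuous_theta a b)

theorem theta_swap (a b : Fin m) (t : unitInterval) :
    theta a b t = theta b a (unitInterval.symm t) :=
  Quotient.sound (ColoredMetricGraph.theta_swap a b t)

theorem theta_zero (a a' b : Fin m) : theta a b 0 = theta a' b 0 :=
  Quotient.sound (ColoredMetricGraph.theta_zero a a' b)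

theorem theta_one (a b b' : Fin m) : theta a b 1 = theta a b' 1 := by
  rw [theta_swap, theta_swap a b', unitInterval.symm_one, theta_zero]

theorem exists_eq_theta (x : MCG m 1 2) : ∃ a b t, x = theta a b t :=
  Quotient.inductionOn x fun x =>
    let ⟨a, b, t, h⟩ := x.exists_equivalent_theta
    ⟨a, b, t, Quotient.sound h⟩

instance : CompactSpace (MCG m 1 2) := by
  have : (Set.univ : Set (MCG m 1 2)) = ⋃ a, ⋃ b, Set.range (theta a b) := by
    ext x
    obtain ⟨a, b, t, h⟩ := exists_eq_theta x
    simp only [Set.mem_univ, Set.mem_iUnion, true_iff]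
    exact ⟨a, b, t, h.symm⟩
  rw [← isCompact_univ_iff, this]
  exact isCompact_iUnion fun a => isCompact_iUnion fun b => isCompact_range (continuous_theta a b)

/-- The color lengths, and an invariant that separates the graphs with two edges of the same
color. -/
noncomputable def coord : MCG m 1 2 → (Fin m → ℝ) × ℝ :=
  Quotient.lift ColoredMetricGraph.coord fun _ _ h =>
    ColoredMetricGraph.Equivalent.coord_eq h

theorem continuous_coord : Continuous (coord : MCG m 1 2 → _) :=
  ColoredMetricGraph.continuous_coord.quotient_lift _

theorem coord_theta (a b : Fin m) (t : unitInterval) :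
    coord (theta a b t) = ((t : ℝ) • Pi.single a 1 + (1 - t : ℝ) • Pi.single b 1,
      if a = b then 2 * (t : ℝ) * (1 - t) else 0) :=
  ColoredMetricGraph.coord_theta a b t

theorem coord_theta_fst (a b c : Fin m) (t : unitInterval) :
    (coord (theta a b t)).1 c =
      (if c = a then (t : ℝ) else 0) + if c = b then (1 - t : ℝ) else 0 := by
  simp [coord_theta, Pi.single_apply]

theorem coord_theta_self (a : Fin m) (t : unitInterval) :
    coord (theta a a t) = (Pi.single a 1, 2 * (t : ℝ) * (1 - t)) := by
  rw [coord_theta, ← add_smul]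
  simp

theorem exists_theta_of_pos {x : MCG m 1 2} {a : Fin m} (h : 0 < (coord x).1 a) :
    ∃ b t, x = theta a b t ∧ (a ≠ b → 0 < (t : ℝ)) := by
  obtain ⟨b, c, t, rfl⟩ := exists_eq_theta x
  rw [coord_theta_fst] at h
  by_cases hb : a = b
  · subst hb
    refine ⟨c, t, rfl, fun hc => ?_⟩
    simpa [hc] using h
  · by_cases hc : a = c
    · subst hc
      refine ⟨b, unitInterval.symm t, theta_swap _ _ _, fun _ => ?_⟩
      simpa [hb] using h
    · simp [hb, hc] at h

theorem exists_coord_pos (x : MCG m 1 2) : ∃ a, 0 < (coord x).1 a := by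
  obtain ⟨a, b, t, rfl⟩ := exists_eq_theta x
  by_contra! h
  have ha := h a
  have hb := h b
  rw [coord_theta_fst] at ha hb
  have h0 := t.2.1
  have h1 := t.2.2
  by_cases hab : a = b
  · simp [hab] at ha
    linarith
  · simp [hab, Ne.symm hab] at ha hb
    linarith

/-- Pick a color `a` of positive length and list it first in both graphs. Equal coordinates then
give equal parameters up to the flip of a whisker, or force an end of a segment, where the other
color is irrelevant. -/
theorem coord_injective : Function.Injective (coord : MCG m 1 2 → _) := by
  intro x y hxy
  obtain ⟨a, ha⟩ := exists_coord_pos x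
  obtain ⟨b, t, rfl, ht⟩ := exists_theta_of_pos ha
  obtain ⟨c, u, rfl, hu⟩ := exists_theta_of_pos (hxy ▸ ha)
  have h := fun d => congrFun (congrArg Prod.fst hxy) d
  simp only [coord_theta_fst] at h
  have h' := congrArg Prod.snd hxy
  simp only [coord_theta] at h'
  by_cases hb : a = b
  · subst hb
    by_cases hc : a = c
    · subst hc
      simp only [if_true] at h'
      -- The height `2t(1-t)` determines `t` up to `t ↦ 1 - t`, which is the exchange of the two
      -- edges.
      have : ((t : ℝ) - u) * (1 - t - u) = 0 := by linear_combination h' / 2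
      rcases mul_eq_zero.1 this with h0 | h0
      · rw [Subtype.ext (sub_eq_zero.1 h0)]
      · rw [theta_swap, show unitInterval.symm t = u from
          Subtype.ext (by rw [unitInterval.coe_symm_eq]; linarith)]
    · have hu1 : u = 1 := Subtype.ext (by simpa [hc] using (h a).symm)
      subst hu1
      have : (t : ℝ) = 0 ∨ (1 - t : ℝ) = 0 := by simpa [hc] using h'
      rcases this with h0 | h0
      · obtain rfl : t = 0 := Subtype.ext h0
        rw [theta_swap, unitInterval.symm_zero, theta_one]
      · obtain rfl : t = 1 := Subtype.ext (sub_eq_zero.1 h0).symm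
        rw [theta_one]
  · have hb' := h b
    by_cases hc : a = c
    · subst hc
      have ht1 : t = 1 := Subtype.ext (by simpa [hb] using h a)
      subst ht1
      have : (u : ℝ) = 0 ∨ (1 - u : ℝ) = 0 := by simpa [hb, eq_comm] using h'
      rcases this with h0 | h0
      · obtain rfl : u = 0 := Subtype.ext h0
        rw [theta_swap a a, unitInterval.symm_zero, theta_one]
      · obtain rfl : u = 1 := Subtype.ext (sub_eq_zero.1 h0).symm
        rw [theta_one]
    · obtain rfl : t = u := Subtype.ext (by simpa [hb, hc] using h a)
      by_cases hbc : b = c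
      · rw [hbc]
      · have h0 : (1 - t : ℝ) = 0 := by simpa [Ne.symm hb, hbc] using h b
        obtain rfl : t = 1 := Subtype.ext (sub_eq_zero.1 h0).symm
        rw [theta_one]

theorem isClosedEmbedding_coord : Topology.IsClosedEmbedding (coord : MCG m 1 2 → _) :=
  continuous_coord.isClosedEmbedding coord_injective

/-- The graphs with an edge of positive length and color `a`. -/
def star (a : Fin m) : Set (MCG m 1 2) := {x | 0 < (coord x).1 a}

theorem isOpen_star (a : Fin m) : IsOpen (star a) :=
  isOpen_lt continuous_const ((continuous_apply a).comp (continuous_fst.comp continuous_coord))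

theorem exists_two_mul_eq {h : ℝ} (h0 : 0 ≤ h) (h1 : h ≤ 1 / 2) :
    ∃ t : unitInterval, 2 * (t : ℝ) * (1 - t) = h := by
  have hs : √(1 - 2 * h) ^ 2 = 1 - 2 * h := Real.sq_sqrt (by linarith)
  have hs1 : √(1 - 2 * h) ≤ 1 := Real.sqrt_le_one.2 (by linarith)
  have hs0 := Real.sqrt_nonneg (1 - 2 * h)
  exact ⟨⟨(1 - √(1 - 2 * h)) / 2, by linarith, by linarith⟩, by
    linear_combination - hs / 2⟩

/-- The image consists of the vertical whisker over the center and half-open segments towards the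
other vertices, all issuing from the center. -/
theorem starConvex_image_star (a : Fin m) :
    StarConvex ℝ (Pi.single a 1, 0) (coord '' star a) := by
  rintro _ ⟨x, hx, rfl⟩ r s hr hs hrs
  obtain ⟨b, t, rfl, ht⟩ := exists_theta_of_pos hx
  by_cases hb : a = b
  · subst hb
    -- The height on the whisker is not linear in `t`, so the parameter is solved for from the
    -- height scaled by `s`; heights never exceed `1 / 2`.
    obtain ⟨u, hu⟩ := exists_two_mul_eq (h := s * (2 * t * (1 - t)))
      (by have := t.2.1; have := sub_nonneg.2 t.2.2; positivity)
      (by nlinarith [sq_nonneg (2 * (t : ℝ) - 1), t.2.1, t.2.2])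
    have hcoord : coord (theta a a u) = r • ((Pi.single a 1 : Fin m → ℝ), (0 : ℝ)) +
        s • coord (theta a a t) := by
      rw [coord_theta_self, coord_theta_self, hu, Prod.smul_mk, Prod.smul_mk, Prod.mk_add_mk,
        ← add_smul, hrs]
      simp
    refine ⟨theta a a u, ?_, hcoord⟩
    simp [star, coord_theta_self]
  · have ht0 := ht hb
    have hu : r + s * t ∈ unitInterval := ⟨by positivity, by nlinarith [t.2.2]⟩
    refine ⟨theta a b ⟨r + s * t, hu⟩, ?_, ?_⟩
    · simp only [star, Set.mem_ofPred_eq, coord_theta_fst, hb, if_true, if_false, add_zero]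
      rcases hr.eq_or_lt with rfl | hr
      · rw [zero_add] at hrs
        simpa [hrs] using ht0
      · positivity
    · rw [coord_theta, coord_theta, if_neg hb, if_neg hb]
      refine Prod.ext (funext fun c => ?_) ?_
      · simp only [Prod.fst_add, Prod.smul_fst, Pi.add_apply, Pi.smul_apply, smul_eq_mul]
        linear_combination (- (Pi.single b 1 : Fin m → ℝ) c) * hrs
      · simp

theorem isSimplyConnected_star (a : Fin m) : IsSimplyConnected (star a) := by
  rw [← isClosedEmbedding_coord.isEmbedding.isSimplyConnected_image]
  have hne : (coord '' star a).Nonempty := by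
    refine Set.Nonempty.image _ ⟨theta a a 0, ?_⟩
    simp [star, coord_theta_self]
  have := (starConvex_image_star a).contractibleSpace hne
  exact SimplyConnectedSpace.ofContractible _

theorem image_star_inter_star {a b : Fin m} (hab : a ≠ b) :
    coord '' (star a ∩ star b) =
      openSegment ℝ ((Pi.single a 1 : Fin m → ℝ), (0 : ℝ)) (Pi.single b 1, 0) := by
  ext p
  constructor
  · rintro ⟨x, ⟨hxa, hxb⟩, rfl⟩
    obtain ⟨c, t, rfl, ht⟩ := exists_theta_of_pos hxa
    have hxb' : 0 < (coord (theta a c t)).1 b := hxb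
    rw [coord_theta_fst, if_neg hab.symm, zero_add] at hxb'
    split_ifs at hxb' with hc
    · subst hc
      refine ⟨t, 1 - t, ht hab, hxb', by ring, ?_⟩
      rw [coord_theta, if_neg hab]
      simp
    · exact absurd hxb' (lt_irrefl _)
  · rintro ⟨r, s, hr, hs, hrs, rfl⟩
    obtain rfl : s = 1 - r := by linarith
    refine ⟨theta a b ⟨r, hr.le, by linarith⟩, ⟨?_, ?_⟩, ?_⟩
    · simpa [star, coord_theta_fst, hab] using hr
    · simpa [star, coord_theta_fst, hab.symm] using hs
    · rw [coord_theta, if_neg hab]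
      simp

theorem isPathConnected_star_inter_star (a b : Fin m) : IsPathConnected (star a ∩ star b) := by
  by_cases hab : a = b
  · rw [hab, Set.inter_self]
    exact (isSimplyConnected_star b).isPathConnected
  · rw [isClosedEmbedding_coord.isEmbedding.isInducing.isPathConnected_iff,
      image_star_inter_star hab]
    exact (convex_openSegment _ _).isPathConnected ⟨_, midpoint_mem_openSegment _ _⟩

/-- The cover of the moduli space by the open stars of the vertices of a complete graph. -/
def starCover (m : ℕ) : CompleteGraphCover (MCG m 1 2) (Fin m) where
  set := star
  isOpen_set := isOpen_star
  exists_mem := exists_coord_pos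
  isSimplyConnected := isSimplyConnected_star
  isPathConnected_inter := isPathConnected_star_inter_star
  eq_of_mem a b c := by
    rintro ⟨x, ⟨ha, hb⟩, hc⟩
    obtain ⟨d, t, rfl, -⟩ := exists_theta_of_pos ha
    by_contra! h
    -- A theta graph has at most the two colors `a` and `d`, so every other star containing it is
    -- that of `d`.
    have key : ∀ e, e ≠ a → theta a d t ∈ star e → e = d := fun e hea he => by
      by_contra hed
      simp [star, coord_theta_fst, hea, hed] at he
    exact h.2.1 ((key b h.1.symm hb).trans (key c h.2.2.symm hc).symm)

end MCG

/-! ### Counting edges and conclusion. -/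

theorem card_nonStarEdge (k : ℕ) :
    Fintype.card (CompleteGraphCover.NonStarEdge (0 : Fin (k + 1))) = k * (k - 1) / 2 := by
  let f : (Σ j : Fin k, Fin j) → CompleteGraphCover.NonStarEdge (0 : Fin (k + 1)) := fun p =>
    ⟨(⟨p.2 + 1, by omega⟩, ⟨p.1 + 1, by omega⟩), by
      simp only [ne_eq, Fin.ext_iff, Fin.lt_def, Fin.val_zero]
      omega⟩
  have hf : Function.Bijective f := by
    constructor
    · rintro ⟨⟨j, hj⟩, ⟨i, hi⟩⟩ ⟨⟨j', hj'⟩, ⟨i', hi'⟩⟩ h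
      simp only [f, Subtype.mk.injEq, Prod.mk.injEq, Fin.mk.injEq, Nat.add_right_cancel_iff] at h
      obtain ⟨rfl, rfl⟩ := h
      rfl
    · rintro ⟨⟨⟨i, hi⟩, ⟨j, hj⟩⟩, h⟩
      simp only [ne_eq, Fin.ext_iff, Fin.lt_def, Fin.val_zero] at h
      refine ⟨⟨⟨j - 1, by omega⟩, ⟨i - 1, by simp only; omega⟩⟩, ?_⟩
      simp only [f, Subtype.mk.injEq, Prod.mk.injEq, Fin.mk.injEq]
      omega
  rw [← Fintype.card_congr (Equiv.ofBijective f hf), Fintype.card_sigma]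
  simp only [Fintype.card_fin]
  rw [Fin.sum_univ_eq_sum_range (fun i => i), Finset.sum_range_id]

theorem mainTheorem4 (m : ℕ) (hm : 1 ≤ m) :
    PathConnectedSpace (MCG m 1 2) ∧
      ∀ x : MCG m 1 2,
        Nonempty (FundamentalGroup (MCG m 1 2) x ≃* FreeGroup (Fin ((m - 1) * (m - 2) / 2))) := by
  obtain ⟨k, rfl⟩ := Nat.exists_eq_add_of_le' hm
  refine ⟨(MCG.starCover (k + 1)).pathConnectedSpace, fun x => ?_⟩
  obtain ⟨e⟩ := (MCG.starCover (k + 1)).nonempty_fundamentalGroup_mulEquiv 0 x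
  refine ⟨e.trans (FreeGroup.freeGroupCongr (Fintype.equivFinOfCardEq ?_))⟩
  rw [card_nonStarEdge]
  -- For `m = 1` the truncated `m - 2` does no harm, since the factor `m - 1` vanishes.
  rfl
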